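/- Let $R$ be a commutative Noetherian ring of finite Krull dimension and let $M$ be a finitely generated $R$-module. The (ordinal) length of $M$ is the supremum of the lengths $\alpha$ of all strictly descending chains $(N_\beta)_{\beta\le\alpha}$ of submodules of $M$ indexed by the ordinals $\beta\le\alpha$. Call $M$ univalent if its length equals $\omega^d$ for some natural number $d$. Then $M$ is univalent if and only if its annihilator is a prime ideal $\mathfrak p$ and $M$ is isomorphic, as an $R$-module, to an ideal of $R/\mathfrak p$. -/

import Mathlib

universe u v

/-- The set of lengths of descending chains of submodules of `M`. A strictly descending chain
`(N_β)_{β ≤ α}` indexed by the ordinals `β ≤ α` has length `α`; for finite `α = l` this is the usual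
length `l` of a chain `N_0 ⊋ N_1 ⊋ ⋯ ⊋ N_l`. Equivalently, the members of the set are the order types
of chains of nonzero submodules ordered by reverse inclusion. -/
def chainLengths (R : Type u) (M : Type v) [CommRing R] [AddCommGroup M] [Module R M] :
    Set Ordinal.{v} :=
  {α | ∃ N : Set.Iic α → Submodule R M, StrictAnti N}

/-- The chain lengths are bounded, so that their supremum is a genuine one. -/
theorem bddAbove_chainLengths (R : Type u) (M : Type v) [CommRing R] [AddCommGroup M]
    [Module R M] : BddAbove (chainLengths R M) := by
  refine ⟨(Order.succ (Cardinal.mk (Submodule R M))).ord, ?_⟩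
  rintro α ⟨N, hN⟩
  refine le_of_lt (Cardinal.lt_ord.2 (Order.lt_succ_of_le ?_))
  have hinj : Function.Injective (fun i : α.ToType =>
      N ⟨(Ordinal.ToType.mk.symm i : Set.Iio α), (le_of_lt (Set.mem_Iio.1 (Ordinal.ToType.mk.symm i).2) : _ ≤ α)⟩) := by
    intro i j hij
    have h := hN.injective hij
    have h' : ((Ordinal.ToType.mk.symm i : Set.Iio α) : Ordinal) = Ordinal.ToType.mk.symm j :=
      congrArg (fun x : Set.Iic α => (x : Ordinal)) h
    exact Ordinal.ToType.mk.symm.injective (Subtype.ext h')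
  simpa using Cardinal.mk_le_of_injective hinj

/-- The (ordinal) length of a module: the supremum of the lengths of its descending chains of
submodules. -/
noncomputable def ordinalLength (R : Type u) (M : Type v) [CommRing R] [AddCommGroup M]
    [Module R M] : Ordinal.{v} :=
  sSup (chainLengths R M)

/-- A module is univalent if its length is `ω ^ d` for some natural number `d`. -/
def IsUnivalent (R : Type u) (M : Type v) [CommRing R] [AddCommGroup M] [Module R M] : Prop :=
  ∃ d : ℕ, ordinalLength R M = Ordinal.omega0 ^ d

open Ordinal Set

/-! Let the dimension of a module be the largest coheight of a prime in its support. Dimension below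
`e` forces length below `ω ^ e` (`exists_chainLengths_le`), while a support prime of coheight at
least `d` yields a chain of length `ω ^ d` (`exists_strictAnti_sup_span`). So if `M` has length `ω ^
d`, its dimension is at least `d`, but every quotient by `N ≠ ⊥` has dimension below `d`: otherwise
a chain of length `ω ^ d` above `N` could be prolonged by `⊥`. If `x` kills some `m ≠ 0` and `xM ≠
0`, then `xM ≅ M / ker x` and `M / xM` have dimension below `d`, hence so has `M`, a contradiction.
Thus the annihilator is a prime `p` and `M` is torsion-free over `R/p`; moreover `M / Rm` is killed
by some `r ∉ p`, so multiplication by `r` embeds `M` in `Rm ≅ R/p`. Conversely, a proper quotient of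
a nonzero ideal of `R/p` is killed by some `r ∉ p` and loses dimension, which pins the length to `ω
^ d` with `d` the coheight of `p`. -/

/-! ### Ordinal arithmetic and transfinite chains. -/

/-- A pigeonhole principle replacing natural sums. If neither function gained `ω ^ (d + 1)` over
such a block, their gains would lie below `ω ^ d * N` and `ω ^ d * N'`, which `N + N'` blocks of
length `ω ^ d` contradict. -/
theorem omega0_pow_mul_split {f g : Ordinal.{v} → Ordinal.{v}} {T : Ordinal.{v}}
    (hf : MonotoneOn f (Iic T)) (hg : MonotoneOn g (Iic T))
    (hfg : ∀ x y, x < y → y ≤ T → f x < f y ∨ g x < g y) (d : ℕ) :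
    ∀ (n : ℕ) (s : Ordinal.{v}), s + ω ^ d * n ≤ T → ∃ a b : ℕ, a + b = n ∧
      f s + ω ^ d * a ≤ f (s + ω ^ d * n) ∧ g s + ω ^ d * b ≤ g (s + ω ^ d * n) := by
  have of_single (d : ℕ) (h : ∀ s : Ordinal.{v}, s + ω ^ d ≤ T →
      f s + ω ^ d ≤ f (s + ω ^ d) ∨ g s + ω ^ d ≤ g (s + ω ^ d)) :
      ∀ (n : ℕ) (s : Ordinal.{v}), s + ω ^ d * n ≤ T → ∃ a b : ℕ, a + b = n ∧
        f s + ω ^ d * a ≤ f (s + ω ^ d * n) ∧ g s + ω ^ d * b ≤ g (s + ω ^ d * n) := by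
    intro n
    induction n with
    | zero => intro s _; exact ⟨0, 0, by simp⟩
    | succ n ih =>
      intro s hs
      have e : s + ω ^ d * ((n + 1 : ℕ) : Ordinal.{v}) = s + ω ^ d * n + ω ^ d := by
        push_cast
        rw [mul_add, mul_one, add_assoc]
      rw [e] at hs ⊢
      have hle : s + ω ^ d * n ≤ T := le_self_add.trans hs
      obtain ⟨a, b, hab, ha, hb⟩ := ih s hle
      rcases h _ hs with h | h
      · refine ⟨a + 1, b, by omega, ?_, hb.trans (hg hle hs le_self_add)⟩
        push_cast
        rw [mul_add, mul_one, ← add_assoc]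
        exact (add_le_add_left ha _).trans h
      · refine ⟨a, b + 1, by omega, ha.trans (hf hle hs le_self_add), ?_⟩
        push_cast
        rw [mul_add, mul_one, ← add_assoc]
        exact (add_le_add_left hb _).trans h
  refine of_single d ?_
  induction d with
  | zero =>
    intro s hs
    simp only [pow_zero, Order.add_one_le_iff] at hs ⊢
    exact hfg s (s + 1) (by simp) (Order.add_one_le_of_lt hs)
  | succ d ih =>
    intro s hs
    by_contra! hcon
    have key (x : Ordinal.{v} → Ordinal.{v}) (hx : x (s + ω ^ (d + 1)) < x s + ω ^ (d + 1)) :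
        ∃ N : ℕ, x (s + ω ^ (d + 1)) < x s + ω ^ d * N := by
      rw [pow_succ] at hx ⊢
      obtain ⟨c, hc, hxc⟩ := (lt_add_iff (by simp)).1 hx
      obtain ⟨N, hN, hcN⟩ := (lt_mul_iff_of_isSuccLimit isSuccLimit_omega0).1 hc
      obtain ⟨k, rfl⟩ := lt_omega0.1 hN
      exact ⟨k, hxc.trans_lt (by simpa using hcN)⟩
    obtain ⟨N, hN⟩ := key f hcon.1
    obtain ⟨N', hN'⟩ := key g hcon.2
    have hle : s + ω ^ d * ((N + N' : ℕ) : Ordinal.{v}) ≤ s + ω ^ (d + 1) := by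
      rw [pow_succ]
      gcongr
      exact (natCast_lt_omega0 _).le
    obtain ⟨a, b, hab, ha, hb⟩ := of_single d ih (N + N') s (hle.trans hs)
    have ha' := (ha.trans (hf (hle.trans hs) hs hle)).trans_lt hN
    have hb' := (hb.trans (hg (hle.trans hs) hs hle)).trans_lt hN'
    have pos : (0 : Ordinal.{v}) < ω ^ d := pow_pos omega0_pos d
    rw [add_lt_add_iff_left, mul_lt_mul_iff_right₀ pos, Nat.cast_lt] at ha' hb'
    omega

/-- The image of `g` is well-ordered by reverse order; `f β` is the order type of the values
preceding `g β`. This measures how often a weakly descending family really drops. -/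
theorem exists_rank_of_antitoneOn {P : Type v} [PartialOrder P] [WellFoundedGT P]
    {α : Ordinal.{v}} {g : Ordinal.{v} → P} (hg : AntitoneOn g (Iic α)) :
    ∃ f : Ordinal.{v} → Ordinal.{v}, MonotoneOn f (Iic α) ∧
      (∀ x y, x < y → y ≤ α → g y < g x → f x < f y) ∧
      ∀ β ≤ α, ∃ c : Iic (f β) → P, StrictAnti c := by
  classical
  let r : (g '' Iic α) → (g '' Iic α) → Prop := fun a b => (b : P) < a
  have hr : IsWellOrder (g '' Iic α) r := by
    refine { wf := ?_, trichotomous := ?_ }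
    · exact InvImage.wf (fun a : g '' Iic α => (a : P)) wellFounded_gt
    · rintro ⟨_, x, hx, rfl⟩ ⟨_, y, hy, rfl⟩ h1 h2
      apply Subtype.ext
      rcases le_total x y with h | h
      · exact (hg hx hy h).eq_of_not_lt h1 |>.symm
      · exact (hg hy hx h).eq_of_not_lt h2
  let f : Ordinal.{v} → Ordinal.{v} := fun β =>
    if h : β ≤ α then typein r ⟨g β, β, h, rfl⟩ else 0
  have hf {β} (h : β ≤ α) : f β = typein r ⟨g β, β, h, rfl⟩ := dif_pos h
  refine ⟨f, ?_, ?_, ?_⟩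
  · intro x hx y hy hxy
    rw [hf hx, hf hy, typein_le_typein]
    exact (hg hx hy hxy).not_gt
  · intro x y hxy hy h
    rw [hf (hxy.le.trans hy), hf hy, typein_lt_typein]
    exact h
  · intro β hβ
    rw [hf hβ]
    refine ⟨fun η => (enum r ⟨η, η.2.trans_lt (typein_lt_type r _)⟩ : g '' Iic α), ?_⟩
    intro η η' h
    exact enum_lt_enum (r := r).2 h

theorem exists_strictAnti_mul_omega0 {P : Type*} [PartialOrder P] {δ : Ordinal.{v}} (hδ : δ ≠ 0)
    (b : P) (c : ℕ → Iic δ → P) (hc : ∀ k, StrictAnti (c k)) (hb : ∀ k γ, b ≤ c k γ)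
    (h : ∀ k γ γ', c (k + 1) γ ≤ c k γ') :
    ∃ N : Iic (δ * ω) → P, StrictAnti N ∧ ∀ β, N β = b ∨ ∃ k γ, N β = c k γ := by
  classical
  have hmod (β : Ordinal.{v}) : β % δ ≤ δ := (mod_lt β hδ).le
  have hdiv : ∀ β : Ordinal.{v}, ∃ k : ℕ, β < δ * ω → β / δ = k := fun β => by
    by_cases hβ : β < δ * ω
    · obtain ⟨k, hk⟩ := lt_omega0.1 ((lt_mul_iff_div_lt hδ).1 hβ)
      exact ⟨k, fun _ => hk⟩
    · exact ⟨0, fun h => absurd h hβ⟩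
  choose q hq using hdiv
  have hlt {k l : ℕ} (hkl : k < l) (γ γ') : c l γ ≤ c k γ' := by
    induction l, hkl using Nat.le_induction generalizing γ with
    | base => exact h k γ γ'
    | succ l _ ih => exact (h l γ γ).trans (ih γ)
  -- The concatenation only uses indices below `δ` in each block; the unused last member makes the
  -- junctions strict.
  have hstrict {k l : ℕ} (hkl : k < l) (γ γ' : Iic δ) (hγ : (γ' : Ordinal) < δ) :
      c l γ < c k γ' :=
    (hlt hkl γ ⟨δ, self_mem_Iic⟩).trans_lt (hc k (by exact hγ))
  refine ⟨fun β => if (β : Ordinal) < δ * ω then c (q β) ⟨β % δ, hmod β⟩ else b, ?_, ?_⟩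
  · rintro ⟨β, hβ⟩ ⟨β', hβ'⟩ hlt'
    have hlt' : β < β' := hlt'
    have h1 : β < δ * ω := hlt'.trans_le hβ'
    simp only [h1, if_true]
    have hm := mod_lt β hδ
    split_ifs with h2
    · have hqq : q β ≤ q β' := by
        have : β / δ ≤ β' / δ := div_le_left hlt'.le δ
        rw [hq _ h1, hq _ h2] at this
        exact_mod_cast this
      rcases hqq.lt_or_eq with hqq | hqq
      · exact hstrict hqq _ _ hm
      · rw [← hqq]
        apply hc
        change β % δ < β' % δ
        rw [← div_add_mod β δ, ← div_add_mod β' δ, hq _ h1, hq _ h2, hqq] at hlt'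
        simpa using hlt'
    · exact (hb _ ⟨δ, self_mem_Iic⟩).trans_lt (hc (q β) (by exact hm))
  · rintro ⟨β, hβ⟩
    by_cases h1 : β < δ * ω
    · exact Or.inr ⟨q β, ⟨β % δ, hmod β⟩, by simp [h1]⟩
    · exact Or.inl (by simp [h1])

/-! ### Chains in extensions and quotients. -/

section chains

variable {R : Type u} [CommRing R] {M : Type v} [AddCommGroup M] [Module R M]

theorem exists_strictAntiOn_extension {α : Ordinal.{v}} {c : Iic α → Submodule R M} (hc : StrictAnti c) :
    ∃ g : Ordinal.{v} → Submodule R M, StrictAntiOn g (Iic α) ∧ ∀ β (h : β ≤ α), g β = c ⟨β, h⟩ := by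
  classical
  refine ⟨fun β => if h : β ≤ α then c ⟨β, h⟩ else ⊥, ?_, fun β h => dif_pos h⟩
  intro x hx y hy hxy
  simp only [show x ≤ α from hx, show y ≤ α from hy, dif_pos]
  exact hc hxy

theorem le_ordinalLength {α : Ordinal.{v}} (h : α ∈ chainLengths R M) : α ≤ ordinalLength R M :=
  le_csSup (bddAbove_chainLengths R M) h

theorem ordinalLength_le {α : Ordinal.{v}} (h : ∀ β ∈ chainLengths R M, β ≤ α) :
    ordinalLength R M ≤ α :=
  csSup_le' h

/-- By the modular law, each strict drop in `M` is a drop of the trace on `N` or of the image in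
`Q`. The extra block in `n + m + 1` contradicts the pigeonhole count. -/
theorem chainLengths_le_of_exact {N Q : Type v} [AddCommGroup N] [Module R N] [AddCommGroup Q]
    [Module R Q] [IsNoetherian R N] [IsNoetherian R Q] {f : N →ₗ[R] M} {g : M →ₗ[R] Q}
    (hfg : Function.Exact f g) {d n m : ℕ}
    (hN : ∀ α ∈ chainLengths R N, α ≤ ω ^ d * n) (hQ : ∀ α ∈ chainLengths R Q, α ≤ ω ^ d * m) :
    ∀ α ∈ chainLengths R M, α ≤ ω ^ d * ((n + m + 1 : ℕ) : Ordinal.{v}) := by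
  rintro α ⟨c, hc⟩
  by_contra! hα
  obtain ⟨c, hc, -⟩ := exists_strictAntiOn_extension hc
  obtain ⟨r, hr, hr', hrc⟩ := exists_rank_of_antitoneOn (α := α) (g := fun β => (c β).comap f)
    fun x hx y hy h => Submodule.comap_mono (hc.antitoneOn hx hy h)
  obtain ⟨s, hs, hs', hsc⟩ := exists_rank_of_antitoneOn (α := α) (g := fun β => (c β).map g)
    fun x hx y hy h => Submodule.map_mono (hc.antitoneOn hx hy h)
  have hrs : ∀ x y, x < y → y ≤ α → r x < r y ∨ s x < s y := by
    intro x y hxy hy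
    have hlt : c y < c x := hc (hxy.le.trans hy) hy hxy
    by_contra! hcon
    have h1 : ¬ (c y).comap f < (c x).comap f := fun h => (hr' x y hxy hy h).not_ge hcon.1
    have h2 : ¬ (c y).map g < (c x).map g := fun h => (hs' x y hxy hy h).not_ge hcon.2
    have e1 := (Submodule.comap_mono (f := f) hlt.le).eq_of_not_lt h1
    have e2 := (Submodule.map_mono (f := g) hlt.le).eq_of_not_lt h2
    refine hlt.not_ge fun z hz => ?_
    obtain ⟨w, hw, hwz⟩ : g z ∈ (c y).map g := e2 ▸ Submodule.mem_map_of_mem hz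
    obtain ⟨t, ht⟩ := (hfg (z - w)).1 (by rw [map_sub]; exact sub_eq_zero.2 hwz.symm)
    have : t ∈ (c y).comap f := by
      rw [e1, Submodule.mem_comap, ht]
      exact sub_mem hz (hlt.le hw)
    rw [Submodule.mem_comap, ht] at this
    simpa using add_mem this hw
  obtain ⟨a, b, hab, ha, hb⟩ := omega0_pow_mul_split hr hs hrs d (n + m + 1) 0 (by simpa using hα.le)
  rw [zero_add] at ha hb
  have pos : (0 : Ordinal.{v}) < ω ^ d := pow_pos omega0_pos d
  have ha' := (le_add_self.trans ha).trans (hN _ (hrc _ hα.le))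
  have hb' := (le_add_self.trans hb).trans (hQ _ (hsc _ hα.le))
  rw [mul_le_mul_iff_right₀ pos, Nat.cast_le] at ha' hb'
  omega

theorem mem_chainLengths_quotient {α β : Ordinal.{v}} (hβ : β ≤ α) {c : Iic α → Submodule R M}
    (hc : StrictAnti c) : β ∈ chainLengths R (M ⧸ c ⟨β, hβ⟩) := by
  refine ⟨fun γ => (c ⟨γ, γ.2.trans hβ⟩).map (c ⟨β, hβ⟩).mkQ, fun γ γ' h => ?_⟩
  have hle (γ : Iic β) : c ⟨β, hβ⟩ ≤ c ⟨γ, γ.2.trans hβ⟩ := hc.antitone γ.2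
  have hlt : c ⟨γ', γ'.2.trans hβ⟩ < c ⟨γ, γ.2.trans hβ⟩ := hc h
  refine lt_of_le_of_ne (Submodule.map_mono hlt.le) fun he => hlt.ne ?_
  have := congrArg (Submodule.comap (c ⟨β, hβ⟩).mkQ) he
  simpa [Submodule.comap_map_mkQ, hle] using this

end chains

/-! ### Length against dimension of the support. -/

theorem exists_gt_of_succ_le_coheight {α : Type*} [Preorder α] {a : α} {d : ℕ}
    (h : ((d + 1 : ℕ) : ℕ∞) ≤ Order.coheight a) : ∃ b > a, (d : ℕ∞) ≤ Order.coheight b := by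
  by_contra! hcon
  have := h.trans (Order.coheight_le_coe_iff.2 hcon)
  rw [Nat.cast_le] at this
  omega

section bounds

variable {R : Type u} [CommRing R]

theorem exists_strictAnti_sup_span {M : Type v} [AddCommGroup M] [Module R M] (d : ℕ) :
    ∀ (B : Submodule R M) (m : M) (p : PrimeSpectrum R), (∀ r : R, r • m ∈ B → r ∈ p.asIdeal) →
      (d : ℕ∞) ≤ Order.coheight p → ∃ c : Iic ((ω : Ordinal.{v}) ^ d) → Submodule R M,
        StrictAnti c ∧ ∀ γ, B ≤ c γ ∧ c γ ≤ B ⊔ Submodule.span R {m} := by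
  classical
  induction d with
  | zero =>
    intro B m p hm _
    have hlt : B < B ⊔ Submodule.span R {m} := by
      refine lt_of_le_of_ne le_sup_left fun h => p.2.ne_top ?_
      rw [Ideal.eq_top_iff_one]
      refine hm 1 ?_
      rw [one_smul, h]
      exact Submodule.mem_sup_right (Submodule.mem_span_singleton_self m)
    refine ⟨fun γ => if (γ : Ordinal.{v}) = 0 then B ⊔ Submodule.span R {m} else B, ?_, ?_⟩
    · rintro ⟨x, hx⟩ ⟨y, hy⟩ hxy
      have hxy : x < y := hxy
      have hy' : y ≤ 1 := by simpa using hy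
      have hx0 : x = 0 := Order.lt_one_iff.1 (hxy.trans_le hy')
      have hy0 : y ≠ 0 := by rintro rfl; exact not_lt_zero hxy
      simpa [hx0, hy0] using hlt
    · intro γ
      dsimp only
      split_ifs
      · exact ⟨le_sup_left, le_rfl⟩
      · exact ⟨le_rfl, le_sup_left⟩
  | succ d ih =>
    intro B m p hm hd
    obtain ⟨q, hpq, hq⟩ := exists_gt_of_succ_le_coheight hd
    obtain ⟨x, hxq, hxp⟩ := SetLike.exists_of_lt (show p.asIdeal < q.asIdeal from hpq)
    -- Modulo `C` the annihilator of `m` is exactly `p`, so powers of `x ∉ p` can be cancelled.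
    let C : Submodule R M := B ⊔ p.asIdeal • Submodule.span R {m}
    have hCm : C ≤ B ⊔ Submodule.span R {m} := sup_le_sup_left Submodule.smul_le_right _
    have hC (r : R) (hr : r • m ∈ C) : r ∈ p.asIdeal := by
      obtain ⟨b, hb, z, hz, hbz⟩ := Submodule.mem_sup.1 hr
      obtain ⟨s, hs, rfl⟩ := Submodule.mem_smul_span_singleton.1 hz
      have : r - s ∈ p.asIdeal := by
        refine hm _ ?_
        rw [sub_smul, ← hbz, add_sub_cancel_right]
        exact hb
      simpa using add_mem this hs
    -- Each layer between consecutive multiples `x ^ k • m` has annihilator inside `q`, so it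
    -- carries a chain of length `ω ^ d`.
    have hpow (k : ℕ) (r : R) (hr : r • x ^ k • m ∈ C ⊔ Submodule.span R {x ^ (k + 1) • m}) :
        r ∈ q.asIdeal := by
      obtain ⟨b, hb, z, hz, hbz⟩ := Submodule.mem_sup.1 hr
      obtain ⟨s, rfl⟩ := Submodule.mem_span_singleton.1 hz
      have h1 : (r - s * x) * x ^ k ∈ p.asIdeal := by
        refine hC _ ?_
        have : ((r - s * x) * x ^ k) • m = b := by
          rw [← add_sub_cancel_right b (s • x ^ (k + 1) • m), hbz]
          simp only [smul_smul, ← sub_smul]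
          congr 1
          ring
        rwa [this]
      have h2 := (p.2.mem_or_mem h1).resolve_right fun h => hxp (p.2.mem_of_pow_mem _ h)
      simpa using add_mem (hpq.le h2) (q.asIdeal.mul_mem_left s hxq)
    choose c hc hcB using fun k => ih _ _ q (hpow k) hq
    have hstep (k : ℕ) : C ⊔ Submodule.span R {x ^ (k + 1) • m} ⊔ Submodule.span R {x ^ k • m} ≤
        C ⊔ Submodule.span R {x ^ k • m} := by
      refine sup_le (sup_le_sup_left ?_ _) le_sup_right
      rw [Submodule.span_singleton_le_iff_mem, pow_succ', mul_smul]
      exact Submodule.smul_mem _ _ (Submodule.mem_span_singleton_self _)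
    have pos : (ω : Ordinal.{v}) ^ d ≠ 0 := (pow_pos omega0_pos d).ne'
    obtain ⟨N, hN, hNB⟩ := exists_strictAnti_mul_omega0 pos B c hc
      (fun k γ => le_sup_left.trans (le_sup_left.trans (hcB k γ).1))
      fun k γ γ' => ((hcB (k + 1) γ).2.trans (hstep _)).trans (hcB k γ').1
    rw [pow_succ]
    refine ⟨N, hN, fun γ => ?_⟩
    rcases hNB γ with h | ⟨k, γ', h⟩ <;> rw [h]
    · exact ⟨le_rfl, le_sup_left⟩
    · refine ⟨le_sup_left.trans (le_sup_left.trans (hcB k γ').1),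
        ((hcB k γ').2.trans (hstep k)).trans (sup_le hCm ?_)⟩
      rw [Submodule.span_singleton_le_iff_mem]
      exact Submodule.mem_sup_right
        (Submodule.smul_mem _ _ (Submodule.mem_span_singleton_self _))

/-- A bound on the quotients by nonzero submodules bounds the module itself. -/
theorem chainLengths_le_of_quotient {M : Type v} [AddCommGroup M] [Module R M] {δ : Ordinal.{v}}
    (h : ∀ K : Submodule R M, K ≠ ⊥ → δ ∉ chainLengths R (M ⧸ K)) :
    ∀ α ∈ chainLengths R M, α ≤ δ := by
  rintro α ⟨c, hc⟩
  by_contra! hα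
  refine h (c ⟨δ, hα.le⟩) (fun hbot => ?_) (mem_chainLengths_quotient hα.le hc)
  have : c ⟨α, self_mem_Iic⟩ < c ⟨δ, hα.le⟩ := hc (by exact hα)
  rw [hbot] at this
  exact not_lt_bot this

theorem coheight_lt_of_mem_support_quotient {M : Type v} [AddCommGroup M] [Module R M]
    {p : PrimeSpectrum R} {e : ℕ} (hp : Order.coheight p ≤ e)
    (hann : p.asIdeal ≤ Module.annihilator R M)
    {K : Submodule R M} {r : R} (hr : r ∉ p.asIdeal) (hrK : ∀ m : M, r • m ∈ K)
    {q : PrimeSpectrum R} (hq : q ∈ Module.support R (M ⧸ K)) : Order.coheight q < e := by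
  have hq' := Module.annihilator_le_of_mem_support hq
  have hpq : p < q := by
    refine lt_of_le_of_ne (hann.trans (le_trans ?_ hq')) ?_
    · exact LinearMap.annihilator_le_of_surjective K.mkQ K.mkQ_surjective
    · rintro rfl
      refine hr (hq' (Module.mem_annihilator.2 fun z => ?_))
      obtain ⟨m, rfl⟩ := K.mkQ_surjective z
      rw [← map_smul]
      exact (Submodule.Quotient.mk_eq_zero K).2 (hrK m)
  exact Order.coheight_le_coe_iff.1 hp q hpq

theorem exists_smul_mem_of_linearEquiv_ideal {M : Type v} [AddCommGroup M] [Module R M]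
    {p : Ideal R} {I : Ideal (R ⧸ p)} (e : M ≃ₗ[R] I) {K : Submodule R M} (hK : K ≠ ⊥) :
    ∃ r ∉ p, ∀ m : M, r • m ∈ K := by
  obtain ⟨k, hk, hk0⟩ := K.exists_mem_ne_zero_of_ne_bot hK
  obtain ⟨r, hr⟩ := Ideal.Quotient.mk_surjective (e k : R ⧸ p)
  refine ⟨r, fun h => hk0 ?_, fun m => ?_⟩
  · apply e.injective
    rw [map_zero]
    apply Subtype.ext
    rw [← hr, Ideal.Quotient.eq_zero_iff_mem.2 h]
    rfl
  · obtain ⟨s, hs⟩ := Ideal.Quotient.mk_surjective (e m : R ⧸ p)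
    -- Cross-multiplication in `R/p`, where `r` and `s` represent `k` and `m`.
    have : r • m = s • k := by
      apply e.injective
      apply Subtype.ext
      rw [map_smul, map_smul, Submodule.coe_smul_of_tower, Submodule.coe_smul_of_tower, ← hr, ← hs,
        Algebra.smul_def, Algebra.smul_def, Ideal.Quotient.algebraMap_eq, mul_comm]
    rw [this]
    exact K.smul_mem s hk

theorem exists_chainLengths_le [IsNoetherianRing R] (e : ℕ) :
    ∀ (M : Type v) [AddCommGroup M] [Module R M] [Module.Finite R M],
      (∀ q ∈ Module.support R M, Order.coheight q < e) →
      ∃ γ < (ω : Ordinal.{v}) ^ e, ∀ α ∈ chainLengths R M, α ≤ γ := by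
  induction e with
  | zero =>
    intro M _ _ _ h
    have : Subsingleton M := by
      rw [← Module.support_eq_empty_iff (R := R), Set.eq_empty_iff_forall_notMem]
      intro q hq
      simpa using h q hq
    refine ⟨0, by simp, ?_⟩
    rintro α ⟨c, hc⟩
    by_contra! hα
    exact (hc (show (⟨0, hα.le⟩ : Iic α) < ⟨α, self_mem_Iic⟩ from hα)).ne (Subsingleton.elim _ _)
  | succ e ih =>
    intro M _ _ hfin hM
    suffices H : ∃ n : ℕ, ∀ α ∈ chainLengths R M, α ≤ ω ^ e * n by
      obtain ⟨n, hn⟩ := H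
      refine ⟨_, ?_, hn⟩
      rw [pow_succ]
      exact mul_lt_mul_of_pos_left (natCast_lt_omega0 n) (pow_pos omega0_pos e)
    revert hM
    induction hfin using IsNoetherianRing.induction_on_isQuotientEquivQuotientPrime R with
    | subsingleton N =>
      intro _
      refine ⟨0, ?_⟩
      rintro α ⟨c, hc⟩
      by_contra! hα
      have hα : 0 < α := by simpa using hα
      exact (hc (show (⟨0, hα.le⟩ : Iic α) < ⟨α, self_mem_Iic⟩ from hα)).ne (Subsingleton.elim _ _)
    | quotient N p f =>
      intro hN
      have hann : Module.annihilator R N = p.asIdeal := by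
        rw [f.annihilator_eq, Ideal.annihilator_quotient]
      have hp : Order.coheight p ≤ e := by
        have := hN p (Module.mem_support_iff_of_finite.2 hann.le)
        rw [Nat.cast_add, Nat.cast_one] at this
        exact Order.le_of_lt_add_one this
      refine ⟨1, ?_⟩
      rw [Nat.cast_one, mul_one]
      refine chainLengths_le_of_quotient fun K hK hmem => ?_
      obtain ⟨r, hr, hrK⟩ := exists_smul_mem_of_linearEquiv_ideal
        (f.trans ((Submodule.topEquiv (R := R ⧸ p.1) (M := R ⧸ p.1)).symm.restrictScalars R)) hK
      obtain ⟨γ, hγ, hle⟩ := ih (N ⧸ K) fun q hq =>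
        coheight_lt_of_mem_support_quotient hp hann.ge hr hrK hq
      exact (hle _ hmem).not_gt hγ
    | exact N₁ N₂ N₃ f g hf hg hfg ih₁ ih₃ =>
      intro hN
      rw [Module.support_of_exact hfg hf hg] at hN
      obtain ⟨n, hn⟩ := ih₁ fun q hq => hN q (Or.inl hq)
      obtain ⟨m, hm⟩ := ih₃ fun q hq => hN q (Or.inr hq)
      exact ⟨_, chainLengths_le_of_exact hfg hn hm⟩

end bounds

/-! ### Structure of modules of length `ω ^ d`. -/

theorem coheight_lt_of_ordinalLength_eq {R : Type u} {M : Type v} [CommRing R] [AddCommGroup M]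
    [Module R M] {d : ℕ} (h : ordinalLength R M = ω ^ d) {N : Submodule R M} (hN : N ≠ ⊥)
    {q : PrimeSpectrum R} (hq : q ∈ Module.support R (M ⧸ N)) : Order.coheight q < d := by
  classical
  by_contra! hd
  obtain ⟨z, hz⟩ := Module.mem_support_iff'.1 hq
  obtain ⟨m, rfl⟩ := N.mkQ_surjective z
  obtain ⟨c, hc, hcN⟩ := exists_strictAnti_sup_span d N m q (fun r hr => by
    by_contra hrq
    refine hz r hrq ?_
    rw [← map_smul]
    exact (Submodule.Quotient.mk_eq_zero N).2 hr) hd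
  suffices (ω : Ordinal.{v}) ^ d + 1 ∈ chainLengths R M by
    exact (lt_add_one _).not_ge (h ▸ le_ordinalLength this)
  refine ⟨fun β => if h : (β : Ordinal.{v}) ≤ ω ^ d then c ⟨β, h⟩ else ⊥, ?_⟩
  rintro ⟨x, hx⟩ ⟨y, hy⟩ hxy
  have hxy : x < y := hxy
  have hx' : x ≤ ω ^ d := Order.lt_add_one_iff.1 (hxy.trans_le hy)
  simp only [hx', dif_pos]
  split_ifs with hy'
  · exact hc hxy
  · exact (bot_lt_iff_ne_bot.2 hN).trans_le (hcN _).1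

theorem exists_le_coheight_of_ordinalLength_eq {R : Type u} {M : Type v} [CommRing R]
    [IsNoetherianRing R] [AddCommGroup M] [Module R M] [Module.Finite R M] {d : ℕ}
    (h : ordinalLength R M = ω ^ d) :
    ∃ q ∈ Module.support R M, (d : ℕ∞) ≤ Order.coheight q := by
  by_contra! hcon
  obtain ⟨γ, hγ, hle⟩ := exists_chainLengths_le d M hcon
  exact ((ordinalLength_le hle).trans_lt hγ).ne h

theorem smul_eq_zero_of_ordinalLength_eq {R : Type u} {M : Type v} [CommRing R]
    [IsNoetherianRing R] [AddCommGroup M] [Module R M] [Module.Finite R M] {d : ℕ}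
    (h : ordinalLength R M = ω ^ d) {x : R} {m : M} (hm : m ≠ 0) (hx : x • m = 0) (z : M) :
    x • z = 0 := by
  let φ : M →ₗ[R] M := LinearMap.lsmul R M x
  have hker : LinearMap.ker φ ≠ ⊥ := (Submodule.ne_bot_iff _).2 ⟨m, hx, hm⟩
  by_contra hz
  have hrange : LinearMap.range φ ≠ ⊥ := (Submodule.ne_bot_iff _).2 ⟨x • z, ⟨z, rfl⟩, hz⟩
  obtain ⟨q, hq, hd⟩ := exists_le_coheight_of_ordinalLength_eq h
  rw [Module.support_of_exact (LinearMap.exact_subtype_mkQ (LinearMap.range φ))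
    (Submodule.subtype_injective _) (Submodule.mkQ_surjective _)] at hq
  refine hd.not_gt ?_
  rcases hq with hq | hq
  · rw [← φ.quotKerEquivRange.support_eq] at hq
    exact coheight_lt_of_ordinalLength_eq h hker hq
  · exact coheight_lt_of_ordinalLength_eq h hrange hq

theorem isPrime_annihilator_of_ordinalLength_eq {R : Type u} {M : Type v} [CommRing R]
    [IsNoetherianRing R] [AddCommGroup M] [Module R M] [Module.Finite R M] {d : ℕ}
    (h : ordinalLength R M = ω ^ d) : (Module.annihilator R M).IsPrime := by
  obtain ⟨q, hq, -⟩ := exists_le_coheight_of_ordinalLength_eq h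
  refine ⟨fun htop => q.2.ne_top (top_le_iff.1 (htop ▸ Module.annihilator_le_of_mem_support hq)),
    fun {x y} hxy => ?_⟩
  rw [or_iff_not_imp_right]
  intro hy
  simp only [Module.mem_annihilator, not_forall] at hy ⊢
  obtain ⟨z, hz⟩ := hy
  refine fun m => smul_eq_zero_of_ordinalLength_eq h hz ?_ m
  rw [smul_smul]
  exact Module.mem_annihilator.1 hxy z

theorem exists_linearEquiv_ideal_of_ordinalLength_eq {R : Type u} {M : Type v} [CommRing R]
    [IsNoetherianRing R] [AddCommGroup M] [Module R M] [Module.Finite R M] {d : ℕ}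
    (h : ordinalLength R M = ω ^ d) :
    ∃ I : Ideal (R ⧸ Module.annihilator R M), Nonempty (M ≃ₗ[R] I) := by
  have hprime := isPrime_annihilator_of_ordinalLength_eq h
  have htf {x : R} {m : M} (hx : x ∉ Module.annihilator R M) (hxm : x • m = 0) : m = 0 := by
    by_contra hm
    exact hx (Module.mem_annihilator.2 (smul_eq_zero_of_ordinalLength_eq h hm hxm))
  obtain ⟨q, hq, hd⟩ := exists_le_coheight_of_ordinalLength_eq h
  have hnt : Nontrivial M := Module.nonempty_support_iff.1 ⟨q, hq⟩
  obtain ⟨m, hm⟩ := exists_ne (0 : M)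
  let N := Submodule.span R {m}
  have hN : N ≠ ⊥ := by simpa [N] using hm
  obtain ⟨r, hr, hrN⟩ : ∃ r ∉ Module.annihilator R M, ∀ z : M, r • z ∈ N := by
    -- Otherwise the annihilator of `M` would be a prime in the support of `M / Rm`, of coheight at
    -- least that of `q`.
    have hp : ¬ Module.annihilator R (M ⧸ N) ≤ Module.annihilator R M := fun hle =>
      (hd.trans (Order.coheight_anti (show (⟨_, hprime⟩ : PrimeSpectrum R) ≤ q from
        Module.annihilator_le_of_mem_support hq))).not_gt
          (coheight_lt_of_ordinalLength_eq h hN (Module.mem_support_iff_of_finite.2 hle))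
    obtain ⟨r, hr, hr'⟩ := SetLike.not_le_iff_exists.1 hp
    refine ⟨r, hr', fun z => ?_⟩
    have := Module.mem_annihilator.1 hr (N.mkQ z)
    rw [← map_smul] at this
    exact (Submodule.Quotient.mk_eq_zero N).1 this
  have htor : Ideal.torsionOf R M m = Module.annihilator R M := by
    ext x
    rw [Ideal.mem_torsionOf_iff]
    refine ⟨fun hx => ?_, fun hx => Module.mem_annihilator.1 hx m⟩
    by_contra hx'
    exact hm (htf hx' hx)
  let e : N ≃ₗ[R] R ⧸ Module.annihilator R M :=
    ((Ideal.quotTorsionOfEquivSpanSingleton R M m).symm.trans (Submodule.quotEquivOfEq _ _ htor))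
  let φ : M →ₗ[R] R ⧸ Module.annihilator R M :=
    e.toLinearMap ∘ₗ (LinearMap.lsmul R M r).codRestrict N hrN
  have hφ : Function.Injective φ := by
    refine e.injective.comp ?_
    rw [← LinearMap.ker_eq_bot, LinearMap.ker_eq_bot']
    exact fun z hz => htf hr (congrArg Subtype.val hz)
  let I : Ideal (R ⧸ Module.annihilator R M) :=
    { carrier := range φ
      add_mem' := fun {a b} ha hb => (LinearMap.range φ).add_mem ha hb
      zero_mem' := (LinearMap.range φ).zero_mem
      smul_mem' := fun c x hx => by
        obtain ⟨s, rfl⟩ := Ideal.Quotient.mk_surjective c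
        have := (LinearMap.range φ).smul_mem s hx
        rwa [Algebra.smul_def] at this }
  let E : M ≃ₗ[R] LinearMap.range φ := LinearEquiv.ofInjective φ hφ
  exact ⟨I, ⟨{ toFun := fun z => ⟨φ z, z, rfl⟩
               map_add' := fun a b => Subtype.ext (map_add φ a b)
               map_smul' := fun c a => Subtype.ext (map_smul φ c a)
               invFun := fun y => E.symm ⟨y.1, y.2⟩
               left_inv := fun z => E.symm_apply_apply z
               right_inv := fun y => Subtype.ext (congrArg Subtype.val
                 (E.apply_symm_apply ⟨y.1, y.2⟩)) }⟩⟩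

/-! ### Length of ideals of `R/p` and the equivalence. -/

theorem ordinalLength_eq_of_linearEquiv_ideal {R : Type u} {M : Type v} [CommRing R]
    [IsNoetherianRing R] [AddCommGroup M] [Module R M] [Module.Finite R M]
    {p : PrimeSpectrum R} (hp : Module.annihilator R M = p.asIdeal) {I : Ideal (R ⧸ p.asIdeal)}
    (f : M ≃ₗ[R] I) {d : ℕ} (hd : Order.coheight p = d) : ordinalLength R M = ω ^ d := by
  refine le_antisymm (ordinalLength_le (chainLengths_le_of_quotient fun K hK hmem => ?_)) ?_
  · obtain ⟨r, hr, hrK⟩ := exists_smul_mem_of_linearEquiv_ideal f hK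
    obtain ⟨γ, hγ, hle⟩ := exists_chainLengths_le d (M ⧸ K) fun q hq =>
      coheight_lt_of_mem_support_quotient hd.le hp.ge hr hrK hq
    exact (hle _ hmem).not_gt hγ
  · obtain ⟨m, hm⟩ := Module.mem_support_iff'.1 (Module.mem_support_iff_of_finite.2 hp.le)
    obtain ⟨c, hc, -⟩ := exists_strictAnti_sup_span d ⊥ m p (fun r hr => by
      by_contra hrp
      exact hm r hrp hr) hd.ge
    exact le_ordinalLength ⟨c, hc⟩

theorem theoremT {R : Type u} {M : Type v} [CommRing R] [IsNoetherianRing R]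
    (hdim : ringKrullDim R < ⊤) [AddCommGroup M] [Module R M] [Module.Finite R M] :
    IsUnivalent R M ↔
      (Module.annihilator R M).IsPrime ∧
        ∃ I : Ideal (R ⧸ Module.annihilator R M), Nonempty (M ≃ₗ[R] I) := by
  constructor
  · rintro ⟨d, hd⟩
    exact ⟨isPrime_annihilator_of_ordinalLength_eq hd,
      exists_linearEquiv_ideal_of_ordinalLength_eq hd⟩
  · rintro ⟨hprime, I, ⟨f⟩⟩
    let p : PrimeSpectrum R := ⟨Module.annihilator R M, hprime⟩
    -- Finite Krull dimension makes the exponent a natural number.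
    have hp : Order.coheight p ≠ ⊤ := fun htop => by
      have := (Order.coheight_le_krullDim p).trans_lt hdim
      rw [htop] at this
      exact lt_irrefl _ this
    obtain ⟨d, hd⟩ := ENat.ne_top_iff_exists.1 hp
    exact ⟨d, ordinalLength_eq_of_linearEquiv_ideal (p := p) rfl f hd.symm⟩
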